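/- For $n\in\mathbb N$ let $\mathcal S_0^n$ be the set of real symmetric $n\times n$ matrices with zero diagonal. For $A\in\mathcal S_0^n$ put $\|A\|_\infty=\max_{i}\sum_{j}|A_{ij}|$. For $J\in\mathcal S_0^n$ the Ising model with interaction matrix $J$ (and zero external field) is the probability distribution $\Pr_J$ on $\{-1,1\}^n$ with $$\Pr\nolimits_J[x]=\frac{1}{Z_J}\exp\left(\tfrac12\,x^\top Jx\right),\qquad Z_J=\sum_{x\in\{-1,1\}^n}\exp\left(\tfrac12\,x^\top Jx\right),$$ and $\mathbf E_J$ denotes the expectation over $X\sim\Pr_J$. For $\gamma,C>0$, the model $\Pr_{J^*}$ is called $(\gamma,C)$-regular if for every $J\in\mathcal S_0^n$ with $\mathbf E_{J^*}\left[\|(J-J^*)X\|_2^2\right]\le\gamma$ we have $$\mathbf E_{J}\left[\|(J-J^*)X\|_2^2\right]\le C\cdot\mathbf E_{J^*}\left[\|(J-J^*)X\|_2^2\right].$$ **Theorem.** For every $\delta>0$ there exist $\epsilon_0>0$ and $C>0$, depending only on $\delta$, such that for every $n$ and every $J^*\in\mathcal S_0^n$ with $\|J^*\|_\infty<1-\delta$,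 the Ising model with interaction matrix $J^*$ is $(\epsilon_0^2,C)$-regular. -/

import Mathlib

namespace Ising

open scoped Matrix

/-- A spin configuration on `n` nodes: `ℤˣ = {1, -1}`. -/
abbrev Config (n : ℕ) : Type := Fin n → ℤˣ

/-- The configuration `x ∈ {-1, 1}ⁿ` as a vector of real numbers. -/
def Config.toVec {n : ℕ} (x : Config n) : Fin n → ℝ := fun i => ((x i : ℤ) : ℝ)

/-- The set of real symmetric `n × n` matrices with zeroes on the diagonal. -/
def symZeroDiag (n : ℕ) : Set (Matrix (Fin n) (Fin n) ℝ) :=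
  {A | A.IsSymm ∧ ∀ i, A i i = 0}

/-- The infinity norm of a matrix, the maximum over the rows of `∑ j, |A i j|`
(and `0` for the empty matrix). -/
noncomputable def infNorm {n : ℕ} (A : Matrix (Fin n) (Fin n) ℝ) : ℝ :=
  ⨆ i, ∑ j, |A i j|

/-- The unnormalised weight `exp (xᵀ J x / 2)` of a configuration. -/
noncomputable def weight {n : ℕ} (J : Matrix (Fin n) (Fin n) ℝ) (x : Config n) : ℝ :=
  Real.exp ((1 / 2 : ℝ) * (x.toVec ⬝ᵥ (J *ᵥ x.toVec)))

/-- The partition function. -/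
noncomputable def partitionFn {n : ℕ} (J : Matrix (Fin n) (Fin n) ℝ) : ℝ :=
  ∑ x : Config n, weight J x

/-- The probability of the configuration `x` under the Ising model with interaction matrix `J`
and zero external field. -/
noncomputable def prob {n : ℕ} (J : Matrix (Fin n) (Fin n) ℝ) (x : Config n) : ℝ :=
  weight J x / partitionFn J

/-- The expectation of `f X`, where `X` is a sample of the Ising model with interaction
matrix `J` and zero external field. -/
noncomputable def expect {n : ℕ} (J : Matrix (Fin n) (Fin n) ℝ) (f : Config n → ℝ) : ℝ :=
  ∑ x : Config n, prob J x * f x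

/-- The squared Euclidean norm `‖A x‖₂²` for a configuration `x`. -/
noncomputable def sqNormMulVec {n : ℕ} (A : Matrix (Fin n) (Fin n) ℝ) (x : Config n) : ℝ :=
  ‖(WithLp.toLp 2 (A *ᵥ x.toVec) : EuclideanSpace ℝ (Fin n))‖ ^ 2

/-- `(γ, C)`-regularity of the Ising model with interaction matrix `Jstar`. -/
def IsRegular {n : ℕ} (Jstar : Matrix (Fin n) (Fin n) ℝ) (γ C : ℝ) : Prop :=
  ∀ J ∈ symZeroDiag n,
    expect Jstar (sqNormMulVec (J - Jstar)) ≤ γ →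
      expect J (sqNormMulVec (J - Jstar)) ≤ C * expect Jstar (sqNormMulVec (J - Jstar))

end Ising

namespace Ising

open scoped Matrix

/-! ### Spins and single-site flips -/

/-! Write `A = J - Jstar`, with rows `a`. Both expectations of `‖A X‖²` are sums over the rows of
second moments of `a ⬝ᵥ X`, and both are compared with the squared Frobenius norm `F` of `A`.

The tool is a Poincaré inequality. A step of Glauber dynamics maps the vector `D` of oscillations of
`f` to at most `(1 - 1/n) D + (1/n) |J| D`. If `|J|` (entrywise) has operator norm at most `1 - η`,
then `‖D‖` shrinks geometrically, and summing the covariances of `f` with its successive increments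
gives `Var f ≤ ‖D‖² / (2η)`.

For linear `f` this gives the upper bound `E (a ⬝ᵥ X)² ≤ (2/η) ‖a‖²` (`expect_dotProduct_sq_le`).
The lower bound (`expect_dotProduct_sq_ge`) is Cauchy–Schwarz against `centredSum`, whose variance
is `O(‖a‖²)` by Poincaré and whose covariance with `a ⬝ᵥ X` is at least `δ ‖a‖²`.

Hence a small expectation under `Jstar` makes `F` small, so `|J|` still has norm at most `1 - δ/2`,
and the upper bound holds under `J` too. -/

theorem abs_tanh_sub_tanh_le (a b : ℝ) : |Real.tanh a - Real.tanh b| ≤ |a - b| := by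
  have hderiv (x : ℝ) : HasDerivAt Real.tanh (1 - Real.tanh x ^ 2) x := by
    have h := (Real.hasDerivAt_sinh x).div (Real.hasDerivAt_cosh x) (Real.cosh_pos x).ne'
    have hfun : Real.tanh = Real.sinh / Real.cosh := by
      ext y
      simp [Real.tanh_eq_sinh_div_cosh]
    rw [hfun]
    refine h.congr_deriv ?_
    have := (Real.cosh_pos x).ne'
    rw [Pi.div_apply]
    field_simp
  have h := Convex.norm_image_sub_le_of_norm_hasDerivWithin_le (f := Real.tanh)
    (f' := fun x => 1 - Real.tanh x ^ 2) (C := 1) (s := Set.univ) (x := b) (y := a)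
    (fun x _ => (hderiv x).hasDerivWithinAt)
    (fun x _ => by
      have h1 := Real.tanh_sq_lt_one x
      rw [Real.norm_eq_abs, abs_le]
      constructor <;> nlinarith [sq_nonneg (Real.tanh x)])
    convex_univ (Set.mem_univ _) (Set.mem_univ _)
  simpa using h

theorem abs_tanh_le_abs (a : ℝ) : |Real.tanh a| ≤ |a| := by
  simpa using abs_tanh_sub_tanh_le a 0

theorem toVec_sq {n : ℕ} (x : Config n) (i : Fin n) : x.toVec i * x.toVec i = 1 := by
  rcases Int.units_eq_one_or (x i) with h | h <;> simp [Config.toVec, h]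

theorem abs_toVec {n : ℕ} (x : Config n) (i : Fin n) : |x.toVec i| = 1 := by
  rcases Int.units_eq_one_or (x i) with h | h <;> simp [Config.toVec, h]

/-- The configuration with the `i`-th spin reversed. -/
def flip {n : ℕ} (i : Fin n) (x : Config n) : Config n := Function.update x i (-x i)

theorem toVec_flip_self {n : ℕ} (i : Fin n) (x : Config n) :
    (flip i x).toVec i = -x.toVec i := by
  simp [flip, Config.toVec]

theorem toVec_flip_of_ne {n : ℕ} {i j : Fin n} (h : j ≠ i) (x : Config n) :
    (flip i x).toVec j = x.toVec j := by
  simp [flip, Config.toVec, h]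

theorem toVec_flip {n : ℕ} (i : Fin n) (x : Config n) :
    (flip i x).toVec = x.toVec - Pi.single i (2 * x.toVec i) := by
  ext j
  by_cases h : j = i
  · subst h
    rw [toVec_flip_self]
    simp
    ring
  · simp [toVec_flip_of_ne h, h]

theorem flip_flip {n : ℕ} (i : Fin n) (x : Config n) : flip i (flip i x) = x := by
  simp [flip]

theorem flip_comm {n : ℕ} {i j : Fin n} (h : j ≠ i) (x : Config n) :
    flip i (flip j x) = flip j (flip i x) := by
  simp [flip, h, h.symm, Function.update_comm h]

theorem sum_flip {n : ℕ} (i : Fin n) (F : Config n → ℝ) : ∑ x, F (flip i x) = ∑ x, F x :=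
  Equiv.sum_comp (Function.Involutive.toPerm (flip i) (flip_flip i)) F

/-! ### The single-site dynamics -/

/-- The local field at `i`. -/
def field {n : ℕ} (J : Matrix (Fin n) (Fin n) ℝ) (i : Fin n) (x : Config n) : ℝ :=
  (J *ᵥ x.toVec) i

/-- The probability that resampling the spin at `i` reverses it. -/
noncomputable def rate {n : ℕ} (J : Matrix (Fin n) (Fin n) ℝ) (i : Fin n) (x : Config n) : ℝ :=
  (1 - x.toVec i * Real.tanh (field J i x)) / 2

/-- The conditional expectation of `f` given all the spins but the one at `i`. -/
noncomputable def resample {n : ℕ} (J : Matrix (Fin n) (Fin n) ℝ) (i : Fin n)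
    (f : Config n → ℝ) (x : Config n) : ℝ :=
  f x - rate J i x * (f x - f (flip i x))

variable {n : ℕ} {J : Matrix (Fin n) (Fin n) ℝ}

theorem field_flip (i j : Fin n) (x : Config n) :
    field J i (flip j x) = field J i x - 2 * J i j * x.toVec j := by
  simp only [field, toVec_flip, Matrix.mulVec_sub, Pi.sub_apply, Matrix.mulVec_single]
  simp
  ring

theorem field_flip_self (hJ : J ∈ symZeroDiag n) (i : Fin n) (x : Config n) :
    field J i (flip i x) = field J i x := by
  simp [field_flip, hJ.2 i]

theorem abs_field_le (i : Fin n) (x : Config n) : |field J i x| ≤ ∑ j, |J i j| := by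
  rw [field, Matrix.mulVec, dotProduct]
  refine (Finset.abs_sum_le_sum_abs _ _).trans (Finset.sum_le_sum fun j _ => ?_)
  rw [abs_mul, abs_toVec, mul_one]

theorem rate_bounds (i : Fin n) (x : Config n) : 0 ≤ rate J i x ∧ rate J i x ≤ 1 := by
  have h : |x.toVec i * Real.tanh (field J i x)| < 1 := by
    rw [abs_mul, abs_toVec, one_mul]
    exact Real.abs_tanh_lt_one _
  rw [abs_lt] at h
  constructor <;> unfold rate <;> linarith

theorem rate_flip_self (hJ : J ∈ symZeroDiag n) (i : Fin n) (x : Config n) :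
    rate J i (flip i x) = 1 - rate J i x := by
  simp only [rate, field_flip_self hJ, toVec_flip_self]
  ring

/-- Flipping spin `j` moves the field at `i` by `2 |J i j|`; the 1-Lipschitz `tanh` and the factor
`1/2` in the rate leave exactly `|J i j|`. -/
theorem abs_rate_flip_sub_le {i j : Fin n} (h : j ≠ i) (x : Config n) :
    |rate J i x - rate J i (flip j x)| ≤ |J i j| := by
  have h1 : rate J i x - rate J i (flip j x) =
      -(x.toVec i * (Real.tanh (field J i x) - Real.tanh (field J i (flip j x))) / 2) := by
    simp only [rate, toVec_flip_of_ne h.symm]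
    ring
  rw [h1, abs_neg, abs_div, abs_mul, abs_toVec, one_mul]
  have h2 := abs_tanh_sub_tanh_le (field J i x) (field J i (flip j x))
  rw [field_flip (J := J) i j x, sub_sub_cancel, abs_mul, abs_mul, abs_toVec] at h2
  rw [field_flip]
  norm_num at h2 ⊢
  linarith

theorem weight_pos (x : Config n) : 0 < weight J x := Real.exp_pos _

theorem weight_flip (hJ : J ∈ symZeroDiag n) (i : Fin n) (x : Config n) :
    weight J (flip i x) = weight J x * Real.exp (-2 * (x.toVec i * field J i x)) := by
  rw [weight, weight, ← Real.exp_add]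
  congr 1
  have h1 : J *ᵥ Pi.single i (2 * x.toVec i) = fun k => 2 * x.toVec i * J i k := by
    ext k
    rw [Matrix.mulVec_single]
    simp only [Pi.smul_apply, Matrix.col_apply, MulOpposite.smul_eq_mul_unop,
      MulOpposite.unop_op]
    rw [hJ.1.apply, mul_comm]
  have h2 : x.toVec ⬝ᵥ (fun k => 2 * x.toVec i * J i k) = 2 * x.toVec i * field J i x := by
    simp only [dotProduct, field, Matrix.mulVec, Finset.mul_sum]
    exact Finset.sum_congr rfl fun k _ => by ring
  rw [toVec_flip, Matrix.mulVec_sub, dotProduct_sub, sub_dotProduct, sub_dotProduct, h1, h2]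
  simp only [single_dotProduct, hJ.2 i, field]
  ring

/-- Reversibility: it makes each resampling operator self-adjoint under the Ising measure. -/
theorem detailed_balance (hJ : J ∈ symZeroDiag n) (i : Fin n) (x : Config n) :
    weight J (flip i x) * rate J i (flip i x) = weight J x * rate J i x := by
  rw [weight_flip hJ, rate_flip_self hJ, mul_assoc]
  congr 1
  have hx : x.toVec i = 1 ∨ x.toVec i = -1 := by
    have := toVec_sq x i
    exact mul_self_eq_one_iff.mp this
  have hp : ∀ h : ℝ, Real.exp (-2 * h) = Real.exp (-h) / Real.exp h := fun h => by
    rw [← Real.exp_sub]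
    ring_nf
  generalize hh : field J i x = h
  have p1 := Real.exp_pos h
  have p2 := Real.exp_pos (-h)
  rcases hx with hx | hx <;> simp only [rate, hx, hh, one_mul, neg_one_mul, hp, Real.tanh_eq]
    <;> field_simp <;> ring

/-! ### Expectations -/

theorem partitionFn_pos : 0 < partitionFn J :=
  Finset.sum_pos (fun x _ => weight_pos x) Finset.univ_nonempty

theorem prob_pos (x : Config n) : 0 < prob J x := div_pos (weight_pos x) partitionFn_pos

theorem sum_prob : ∑ x, prob J x = 1 := by
  simp only [prob, ← Finset.sum_div]
  exact div_self partitionFn_pos.ne'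

theorem expect_mono {f g : Config n → ℝ} (h : ∀ x, f x ≤ g x) : expect J f ≤ expect J g :=
  Finset.sum_le_sum fun x _ => mul_le_mul_of_nonneg_left (h x) (prob_pos x).le

theorem expect_const (c : ℝ) : expect J (fun _ => c) = c := by
  simp [expect, ← Finset.sum_mul, sum_prob]

theorem expect_sub (f g : Config n → ℝ) :
    expect J (fun x => f x - g x) = expect J f - expect J g := by
  simp [expect, mul_sub, Finset.sum_sub_distrib]

theorem expect_const_mul (c : ℝ) (f : Config n → ℝ) :
    expect J (fun x => c * f x) = c * expect J f := by
  simp only [expect, Finset.mul_sum]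
  exact Finset.sum_congr rfl fun x _ => by ring

theorem expect_sum {ι : Type*} (s : Finset ι) (f : ι → Config n → ℝ) :
    expect J (fun x => ∑ i ∈ s, f i x) = ∑ i ∈ s, expect J (f i) := by
  simp only [expect, Finset.mul_sum]
  exact Finset.sum_comm

theorem abs_expect_le {f : Config n → ℝ} {c : ℝ} (h : ∀ x, |f x| ≤ c) : |expect J f| ≤ c := by
  rw [abs_le]
  constructor
  · rw [← expect_const (J := J) (-c)]
    exact expect_mono fun x => (abs_le.mp (h x)).1
  · rw [← expect_const (J := J) c]
    exact expect_mono fun x => (abs_le.mp (h x)).2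

theorem expect_mul_sq_le (f g : Config n → ℝ) :
    expect J (fun x => f x * g x) ^ 2 ≤
      expect J (fun x => f x ^ 2) * expect J (fun x => g x ^ 2) := by
  refine Finset.sum_sq_le_sum_mul_sum_of_sq_le_mul _ (fun x _ => ?_) (fun x _ => ?_) fun x _ => ?_
  · exact mul_nonneg (prob_pos x).le (sq_nonneg _)
  · exact mul_nonneg (prob_pos x).le (sq_nonneg _)
  · exact le_of_eq (by ring)

/-- The integration by parts formula for resampling one spin. -/
theorem expect_sub_resample_mul (hJ : J ∈ symZeroDiag n) (i : Fin n) (f g : Config n → ℝ) :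
    expect J (fun x => (f x - resample J i f x) * g x) =
      expect J (fun x => rate J i x * ((f x - f (flip i x)) * (g x - g (flip i x)))) / 2 := by
  have hb (x : Config n) : prob J (flip i x) * rate J i (flip i x) = prob J x * rate J i x := by
    simp only [prob, div_mul_eq_mul_div, detailed_balance hJ]
  have h1 : expect J (fun x => (f x - resample J i f x) * g x) =
      ∑ x, prob J x * rate J i x * ((f x - f (flip i x)) * g x) :=
    Finset.sum_congr rfl fun x _ => by simp only [resample]; ring
  -- Reindexing by the flip preserves `prob * rate` by detailed balance; averaging both forms
  -- symmetrises the sum.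
  have h2 : ∑ x, prob J x * rate J i x * ((f x - f (flip i x)) * g x) =
      ∑ x, prob J x * rate J i x * ((f (flip i x) - f x) * g (flip i x)) := by
    rw [← sum_flip i]
    exact Finset.sum_congr rfl fun x _ => by rw [hb, flip_flip]
  have h3 : expect J (fun x => rate J i x * ((f x - f (flip i x)) * (g x - g (flip i x)))) =
      ∑ x, prob J x * rate J i x * ((f x - f (flip i x)) * g x) +
        ∑ x, prob J x * rate J i x * ((f (flip i x) - f x) * g (flip i x)) := by
    rw [← Finset.sum_add_distrib]
    exact Finset.sum_congr rfl fun x _ => by ring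
  rw [h3, ← h2, h1]
  ring

/-- With no external field the measure is invariant under the global reversal `x ↦ -x`. -/
theorem expect_toVec (i : Fin n) : expect J (fun x => x.toVec i) = 0 := by
  have hv (x : Config n) : Config.toVec (-x) = -x.toVec := by
    ext j
    simp [Config.toVec]
  have h : expect J (fun x => x.toVec i) = -expect J (fun x => x.toVec i) := by
    conv_lhs => rw [expect, ← Equiv.sum_comp (Equiv.neg (Config n))]
    simp only [expect, ← Finset.sum_neg_distrib]
    refine Finset.sum_congr rfl fun x _ => ?_
    simp [prob, weight, hv, Matrix.mulVec_neg]
  linarith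

theorem expect_dotProduct (a : Fin n → ℝ) : expect J (fun x => a ⬝ᵥ x.toVec) = 0 := by
  simp only [dotProduct, expect_sum, expect_const_mul, expect_toVec, mul_zero,
    Finset.sum_const_zero]

/-! ### Oscillations under the dynamics -/

/-- `D i` bounds the change of `f` when the `i`-th spin is reversed. -/
def OscBound (f : Config n → ℝ) (D : EuclideanSpace ℝ (Fin n)) : Prop :=
  ∀ x i, |f x - f (flip i x)| ≤ D i

/-- The action of the matrix of the absolute values `|J i j|`. -/
noncomputable def absMulVec (J : Matrix (Fin n) (Fin n) ℝ) (v : EuclideanSpace ℝ (Fin n)) :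
    EuclideanSpace ℝ (Fin n) :=
  WithLp.toLp 2 fun i => ∑ j, |J i j| * v j

/-- The matrix of the absolute values `|J i j|` has Euclidean operator norm at most `1 - η`. -/
def ContractsBy (J : Matrix (Fin n) (Fin n) ℝ) (η : ℝ) : Prop :=
  ∀ v, ‖absMulVec J v‖ ≤ (1 - η) * ‖v‖

theorem OscBound.nonneg {f : Config n → ℝ} {D : EuclideanSpace ℝ (Fin n)} (h : OscBound f D)
    (i : Fin n) : 0 ≤ D i :=
  (abs_nonneg _).trans (h 1 i)

theorem OscBound.abs_sub_le {f : Config n → ℝ} {D : EuclideanSpace ℝ (Fin n)}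
    (h : OscBound f D) (x y : Config n) : |f x - f y| ≤ ∑ i, D i := by
  have key (s : Finset (Fin n)) : ∀ y : Config n, (∀ i ∉ s, y i = x i) →
      |f x - f y| ≤ ∑ i ∈ s, D i := by
    induction s using Finset.induction_on with
    | empty =>
      intro y hy
      have : y = x := funext fun i => hy i (Finset.notMem_empty i)
      simp [this]
    | insert a s ha ih =>
      intro y hy
      rw [Finset.sum_insert ha]
      by_cases hya : y a = x a
      · have := ih y fun i hi => by
          by_cases hia : i = a
          · rw [hia, hya]
          · exact hy i (by simp [hia, hi])
        linarith [h.nonneg a]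
      · have h1 := ih (flip a y) fun i hi => by
          by_cases hia : i = a
          · subst hia
            rw [flip, Function.update_self]
            rcases Int.units_eq_one_or (y i) with h1 | h1 <;>
              rcases Int.units_eq_one_or (x i) with h2 | h2 <;> simp_all
          · rw [flip, Function.update_of_ne hia]
            exact hy i (by simp [hia, hi])
        have h2 := h y a
        rw [abs_sub_comm] at h2
        linarith [_root_.abs_sub_le (f x) (f (flip a y)) (f y)]
  exact key Finset.univ y (by simp)

theorem resample_flip_self (hJ : J ∈ symZeroDiag n) (i : Fin n) (f : Config n → ℝ)
    (x : Config n) : resample J i f (flip i x) = resample J i f x := by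
  simp only [resample, rate_flip_self hJ, flip_flip]
  ring

/-- Resampling mixes two values of `f`, each changing by at most `D j`; the mixing weight itself
changes by at most `|J i j|` and multiplies a difference of size at most `D i`. -/
theorem OscBound.resample_of_ne {f : Config n → ℝ} {D : EuclideanSpace ℝ (Fin n)}
    (h : OscBound f D) {i j : Fin n} (hij : j ≠ i) (x : Config n) :
    |resample J i f x - resample J i f (flip j x)| ≤ D j + |J i j| * D i := by
  obtain ⟨r0, r1⟩ := rate_bounds (J := J) i x
  have h1 : resample J i f x - resample J i f (flip j x) =
      (1 - rate J i x) * (f x - f (flip j x)) +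
        rate J i x * (f (flip i x) - f (flip j (flip i x))) -
        (rate J i x - rate J i (flip j x)) * (f (flip j x) - f (flip i (flip j x))) := by
    simp only [resample, flip_comm hij]
    ring
  have h2 : |(1 - rate J i x) * (f x - f (flip j x))| ≤ (1 - rate J i x) * D j := by
    rw [abs_mul, abs_of_nonneg (sub_nonneg.mpr r1)]
    exact mul_le_mul_of_nonneg_left (h x j) (sub_nonneg.mpr r1)
  have h3 : |rate J i x * (f (flip i x) - f (flip j (flip i x)))| ≤ rate J i x * D j := by
    rw [abs_mul, abs_of_nonneg r0]
    exact mul_le_mul_of_nonneg_left (h _ j) r0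
  have h4 : |(rate J i x - rate J i (flip j x)) * (f (flip j x) - f (flip i (flip j x)))| ≤
      |J i j| * D i := by
    rw [abs_mul]
    exact mul_le_mul (abs_rate_flip_sub_le hij x) (h _ i) (abs_nonneg _) (abs_nonneg _)
  rw [h1]
  refine (abs_sub _ _).trans ?_
  linarith [abs_add_le ((1 - rate J i x) * (f x - f (flip j x)))
    (rate J i x * (f (flip i x) - f (flip j (flip i x))))]

/-- One step of the Glauber dynamics: resample a uniformly random spin. -/
noncomputable def glauber (J : Matrix (Fin n) (Fin n) ℝ) (f : Config n → ℝ) (x : Config n) : ℝ :=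
  (n : ℝ)⁻¹ * ∑ i, resample J i f x

theorem OscBound.glauber (hJ : J ∈ symZeroDiag n) (hn : 0 < n) {f : Config n → ℝ}
    {D : EuclideanSpace ℝ (Fin n)} (h : OscBound f D) :
    OscBound (glauber J f) ((1 - (n : ℝ)⁻¹) • D + (n : ℝ)⁻¹ • absMulVec J D) := by
  intro x j
  have hn' : (0 : ℝ) < n := Nat.cast_pos.mpr hn
  -- The term `i = j` vanishes, because resampling spin `j` forgets its value. This lost `D j` is
  -- the source of the contraction.
  have h1 : |∑ i, (resample J i f x - resample J i f (flip j x))| ≤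
      ∑ i, (D j + |J i j| * D i - if i = j then D j else 0) := by
    refine (Finset.abs_sum_le_sum_abs _ _).trans (Finset.sum_le_sum fun i _ => ?_)
    by_cases hij : i = j
    · subst hij
      simp [resample_flip_self hJ, hJ.2 i]
    · simpa [hij] using h.resample_of_ne (Ne.symm hij) x
  have h2 : ∑ i, (D j + |J i j| * D i - if i = j then D j else 0) =
      n * D j + absMulVec J D j - D j := by
    simp only [Finset.sum_sub_distrib, Finset.sum_add_distrib, absMulVec]
    simp only [Finset.sum_const, Finset.card_univ, Fintype.card_fin, nsmul_eq_mul,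
      Finset.sum_ite_eq', Finset.mem_univ, if_true]
    simp only [hJ.1.apply]
  have h3 : Ising.glauber J f x - Ising.glauber J f (flip j x) =
      (n : ℝ)⁻¹ * ∑ i, (resample J i f x - resample J i f (flip j x)) := by
    rw [Finset.sum_sub_distrib, mul_sub]
    rfl
  rw [h3, abs_mul, abs_of_pos (inv_pos.mpr hn')]
  calc _ ≤ (n : ℝ)⁻¹ * (n * D j + absMulVec J D j - D j) := by
        rw [← h2]
        exact mul_le_mul_of_nonneg_left h1 (inv_pos.mpr hn').le
    _ = _ := by
        simp only [PiLp.add_apply, PiLp.smul_apply, smul_eq_mul]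
        field_simp
        ring

theorem abs_expect_sub_resample_mul_le (hJ : J ∈ symZeroDiag n) {f g : Config n → ℝ}
    {D D' : EuclideanSpace ℝ (Fin n)} (hf : OscBound f D) (hg : OscBound g D') (i : Fin n) :
    |expect J (fun x => (f x - resample J i f x) * g x)| ≤ D i * D' i / 2 := by
  rw [expect_sub_resample_mul hJ, abs_div, abs_two]
  refine div_le_div_of_nonneg_right (abs_expect_le fun x => ?_) zero_le_two
  obtain ⟨r0, r1⟩ := rate_bounds (J := J) i x
  have h := mul_le_mul (hf x i) (hg x i) (abs_nonneg _) (hf.nonneg i)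
  rw [abs_mul, abs_mul, abs_of_nonneg r0]
  have h0 : 0 ≤ |f x - f (flip i x)| * |g x - g (flip i x)| := by positivity
  nlinarith

theorem expect_sub_glauber_mul_le (hJ : J ∈ symZeroDiag n) (hn : 0 < n) {f g : Config n → ℝ}
    {D D' : EuclideanSpace ℝ (Fin n)} (hf : OscBound f D) (hg : OscBound g D') :
    expect J (fun x => (f x - glauber J f x) * g x) ≤ (n : ℝ)⁻¹ * (‖D‖ * ‖D'‖ / 2) := by
  have hn' : (0 : ℝ) < n := Nat.cast_pos.mpr hn
  have h1 : expect J (fun x => (f x - glauber J f x) * g x) =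
      (n : ℝ)⁻¹ * ∑ i, expect J (fun x => (f x - resample J i f x) * g x) := by
    rw [← expect_sum, ← expect_const_mul]
    congr 1
    ext x
    rw [← Finset.sum_mul, Finset.sum_sub_distrib, glauber]
    simp only [Finset.sum_const, Finset.card_univ, Fintype.card_fin, nsmul_eq_mul]
    field_simp
  rw [h1]
  refine mul_le_mul_of_nonneg_left ?_ (inv_pos.mpr hn').le
  calc _ ≤ ∑ i, D i * D' i / 2 := Finset.sum_le_sum fun i _ =>
        (le_abs_self _).trans (abs_expect_sub_resample_mul_le hJ hf hg i)
    _ = inner ℝ D' D / 2 := by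
        rw [← Finset.sum_div, PiLp.inner_apply]
        simp
    _ ≤ _ := by
        rw [mul_comm ‖D‖]
        exact div_le_div_of_nonneg_right (real_inner_le_norm _ _) zero_le_two

/-! ### The Poincaré inequality -/

theorem norm_oscBound_step_le {η : ℝ} (hc : ContractsBy J η) (hn : 0 < n)
    (D : EuclideanSpace ℝ (Fin n)) :
    ‖(1 - (n : ℝ)⁻¹) • D + (n : ℝ)⁻¹ • absMulVec J D‖ ≤ (1 - (n : ℝ)⁻¹ * η) * ‖D‖ := by
  have hn' : (1 : ℝ) ≤ n := Nat.one_le_cast.mpr hn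
  have h0 : 0 ≤ (n : ℝ)⁻¹ := by positivity
  have h1 : (n : ℝ)⁻¹ ≤ 1 := inv_le_one_of_one_le₀ hn'
  refine (norm_add_le _ _).trans ?_
  rw [norm_smul, norm_smul, Real.norm_of_nonneg h0, Real.norm_of_nonneg (sub_nonneg.mpr h1)]
  nlinarith [mul_le_mul_of_nonneg_left (hc D) h0]

/-- Here `g` is the `K`-th Glauber iterate of `f`. The expectation of `f²` telescopes along the
iterates, and each increment is controlled by the oscillation norms, which decay geometrically. -/
theorem exists_glauber_iterate (hJ : J ∈ symZeroDiag n) (hn : 0 < n) {η : ℝ}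
    (hc : ContractsBy J η) (hη1 : η ≤ 1) {f : Config n → ℝ} {D : EuclideanSpace ℝ (Fin n)}
    (hf : OscBound f D) (K : ℕ) :
    ∃ (g : Config n → ℝ) (D' : EuclideanSpace ℝ (Fin n)), OscBound g D' ∧
      ‖D'‖ ≤ (1 - (n : ℝ)⁻¹ * η) ^ K * ‖D‖ ∧
      expect J (fun x => f x ^ 2) ≤ expect J (fun x => g x * f x) +
        ∑ k ∈ Finset.range K, (n : ℝ)⁻¹ * ((1 - (n : ℝ)⁻¹ * η) ^ k * ‖D‖ ^ 2 / 2) := by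
  have hn' : (1 : ℝ) ≤ n := Nat.one_le_cast.mpr hn
  have h0 : 0 ≤ (n : ℝ)⁻¹ := by positivity
  have h1 : (n : ℝ)⁻¹ ≤ 1 := inv_le_one_of_one_le₀ hn'
  have hρ : 0 ≤ 1 - (n : ℝ)⁻¹ * η := by nlinarith
  induction K with
  | zero => exact ⟨f, D, hf, by simp, by simp [sq]⟩
  | succ K ih =>
    obtain ⟨g, D', hg, hD', hE⟩ := ih
    refine ⟨glauber J g, _, hg.glauber hJ hn, ?_, ?_⟩
    · refine (norm_oscBound_step_le hc hn D').trans ?_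
      rw [pow_succ', mul_assoc]
      exact mul_le_mul_of_nonneg_left hD' hρ
    · have h2 := expect_sub_glauber_mul_le hJ hn hg hf
      simp only [sub_mul, expect_sub] at h2
      have h3 : (n : ℝ)⁻¹ * (‖D'‖ * ‖D‖ / 2) ≤
          (n : ℝ)⁻¹ * ((1 - (n : ℝ)⁻¹ * η) ^ K * ‖D‖ ^ 2 / 2) := by
        refine mul_le_mul_of_nonneg_left ?_ h0
        nlinarith [mul_le_mul_of_nonneg_right hD' (norm_nonneg D)]
      rw [Finset.sum_range_succ]
      linarith

/-- A crude bound suffices: its prefactors do not depend on `K`, while `‖D‖` tends to zero along the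
iterates. -/
theorem abs_expect_mul_le_of_oscBound {f g : Config n → ℝ} {D : EuclideanSpace ℝ (Fin n)}
    (hg : OscBound g D) (hf : expect J f = 0) :
    |expect J (fun x => g x * f x)| ≤ n * ‖D‖ * ∑ x, |f x| := by
  have h1 : expect J (fun x => g x * f x) = expect J (fun x => (g x - g 1) * f x) := by
    simp only [sub_mul, expect_sub, expect_const_mul, hf, mul_zero, sub_zero]
  rw [h1]
  refine abs_expect_le fun x => ?_
  rw [abs_mul]
  have h2 : ∑ i, D i ≤ n * ‖D‖ := by
    calc ∑ i, D i ≤ ∑ _i : Fin n, ‖D‖ := Finset.sum_le_sum fun i _ =>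
          (le_abs_self _).trans (PiLp.norm_apply_le D i)
      _ = _ := by simp
  exact mul_le_mul ((hg.abs_sub_le x 1).trans h2)
    (Finset.single_le_sum (f := fun y => |f y|) (fun _ _ => abs_nonneg _) (Finset.mem_univ x))
    (abs_nonneg _) (by positivity)

/-- The Poincaré inequality, with oscillations in place of a Dirichlet form. -/
theorem expect_sq_le_of_oscBound (hJ : J ∈ symZeroDiag n) {η : ℝ} (hη : 0 < η) (hη1 : η ≤ 1)
    (hc : ContractsBy J η) {f : Config n → ℝ} {D : EuclideanSpace ℝ (Fin n)}
    (hf : OscBound f D) (hE : expect J f = 0) :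
    expect J (fun x => f x ^ 2) ≤ ‖D‖ ^ 2 / (2 * η) := by
  -- For `n = 0` the ratio `ρ` below would be `1`; a centred function on a single configuration is
  -- zero.
  rcases Nat.eq_zero_or_pos n with rfl | hn
  · have h1 (x : Config 0) : f x = 0 := by
      rw [← hE, ← expect_const (J := J) (f x)]
      exact congrArg _ (funext fun y => congrArg f (Subsingleton.elim x y))
    simp only [h1, ne_eq, OfNat.ofNat_ne_zero, not_false_eq_true, zero_pow, expect_const]
    positivity
  have hn' : (1 : ℝ) ≤ n := Nat.one_le_cast.mpr hn
  have h0 : 0 < (n : ℝ)⁻¹ := by positivity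
  have h1 : (n : ℝ)⁻¹ ≤ 1 := inv_le_one_of_one_le₀ hn'
  set ρ := 1 - (n : ℝ)⁻¹ * η with hρ_def
  have hρ : 0 ≤ ρ := by nlinarith
  have hρ1 : ρ < 1 := by nlinarith [mul_pos h0 hη]
  have key (K : ℕ) : expect J (fun x => f x ^ 2) ≤
      ρ ^ K * (n * ‖D‖ * ∑ x, |f x|) + ‖D‖ ^ 2 / (2 * η) := by
    obtain ⟨g, D', hg, hD', hgE⟩ := exists_glauber_iterate hJ hn hc hη1 hf K
    have h2 := (le_abs_self _).trans (abs_expect_mul_le_of_oscBound (J := J) hg hE)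
    have h3 : (n : ℝ) * ‖D'‖ * ∑ x, |f x| ≤ ρ ^ K * (n * ‖D‖ * ∑ x, |f x|) := by
      have : (n : ℝ) * ‖D'‖ * ∑ x, |f x| ≤ n * (ρ ^ K * ‖D‖) * ∑ x, |f x| := by gcongr
      linarith
    have h4 : ∑ k ∈ Finset.range K, (n : ℝ)⁻¹ * (ρ ^ k * ‖D‖ ^ 2 / 2) ≤
        ‖D‖ ^ 2 / (2 * η) := by
      have hg : ∑ k ∈ Finset.range K, ρ ^ k ≤ (1 - ρ)⁻¹ := by
        rw [← tsum_geometric_of_lt_one hρ hρ1]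
        exact (summable_geometric_of_lt_one hρ hρ1).sum_le_tsum _ fun k _ => pow_nonneg hρ k
      calc _ = ((n : ℝ)⁻¹ * ‖D‖ ^ 2 / 2) * ∑ k ∈ Finset.range K, ρ ^ k := by
            rw [Finset.mul_sum]
            exact Finset.sum_congr rfl fun k _ => by ring
        _ ≤ ((n : ℝ)⁻¹ * ‖D‖ ^ 2 / 2) * (1 - ρ)⁻¹ := by gcongr
        _ = _ := by
            rw [hρ_def, sub_sub_cancel]
            field_simp
    linarith
  have hlim := (((tendsto_pow_atTop_nhds_zero_of_lt_one hρ hρ1).mul_const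
    (n * ‖D‖ * ∑ x, |f x|)).add_const (‖D‖ ^ 2 / (2 * η)))
  rw [zero_mul, zero_add] at hlim
  exact ge_of_tendsto' hlim key

/-! ### Second moments of linear functions -/

theorem oscBound_dotProduct (a : EuclideanSpace ℝ (Fin n)) :
    OscBound (fun x => a.ofLp ⬝ᵥ x.toVec) (WithLp.toLp 2 fun i => 2 * |a i|) := by
  intro x i
  have h : a.ofLp ⬝ᵥ x.toVec - a.ofLp ⬝ᵥ (flip i x).toVec = 2 * (a i * x.toVec i) := by
    rw [toVec_flip, dotProduct_sub, dotProduct_single]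
    ring
  rw [h, abs_mul, abs_mul, abs_toVec, abs_two, mul_one]

theorem norm_toLp_abs (a : EuclideanSpace ℝ (Fin n)) :
    ‖(WithLp.toLp 2 fun i => |a i| : EuclideanSpace ℝ (Fin n))‖ = ‖a‖ := by
  simp [EuclideanSpace.norm_eq]

theorem toLp_two_mul_abs (a : EuclideanSpace ℝ (Fin n)) :
    (WithLp.toLp 2 fun i => 2 * |a i| : EuclideanSpace ℝ (Fin n)) =
      (2 : ℝ) • WithLp.toLp 2 fun i => |a i| := by
  ext i
  simp

theorem expect_dotProduct_sq_le (hJ : J ∈ symZeroDiag n) {η : ℝ} (hη : 0 < η) (hη1 : η ≤ 1)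
    (hc : ContractsBy J η) (a : EuclideanSpace ℝ (Fin n)) :
    expect J (fun x => (a.ofLp ⬝ᵥ x.toVec) ^ 2) ≤ 2 / η * ‖a‖ ^ 2 := by
  refine (expect_sq_le_of_oscBound hJ hη hη1 hc (oscBound_dotProduct a)
    (expect_dotProduct _)).trans (le_of_eq ?_)
  rw [toLp_two_mul_abs, norm_smul, norm_toLp_abs, Real.norm_ofNat]
  field_simp

/-- The combination of the centred spins `x i - tanh (h i)` with coefficients `a`. -/
noncomputable def centredSum (J : Matrix (Fin n) (Fin n) ℝ) (a : EuclideanSpace ℝ (Fin n))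
    (x : Config n) : ℝ :=
  ∑ i, a i * (x.toVec i - Real.tanh (field J i x))

theorem toVec_sub_resample (i : Fin n) (x : Config n) :
    x.toVec i - resample J i (fun y => y.toVec i) x = x.toVec i - Real.tanh (field J i x) := by
  simp only [resample, toVec_flip_self, rate]
  linear_combination (-Real.tanh (field J i x)) * toVec_sq x i

theorem expect_centredSum_mul (hJ : J ∈ symZeroDiag n) (a : EuclideanSpace ℝ (Fin n))
    (f : Config n → ℝ) :
    expect J (fun x => centredSum J a x * f x) =
      ∑ i, a i * expect J (fun x => rate J i x * (x.toVec i * (f x - f (flip i x)))) := by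
  have h1 : (fun x => centredSum J a x * f x) = fun x => ∑ i, a i *
      ((x.toVec i - resample J i (fun y => y.toVec i) x) * f x) := by
    ext x
    simp only [toVec_sub_resample, centredSum, Finset.sum_mul, mul_assoc]
  rw [h1, expect_sum]
  refine Finset.sum_congr rfl fun i _ => ?_
  rw [expect_const_mul, expect_sub_resample_mul hJ, div_eq_inv_mul, ← expect_const_mul]
  congr 2
  ext x
  rw [toVec_flip_self]
  ring

theorem expect_centredSum (hJ : J ∈ symZeroDiag n) (a : EuclideanSpace ℝ (Fin n)) :
    expect J (centredSum J a) = 0 := by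
  have h := expect_centredSum_mul hJ a fun _ => 1
  simp only [mul_one, sub_self, mul_zero, expect_const, Finset.sum_const_zero] at h
  exact h

/-- Integration by parts turns the covariance into `∑ a i ^ 2 * E (2 * rate)`, and `2 * rate = 1 - x
i * tanh (field)` is at least `δ` because the field is at most `1 - δ` in absolute value. -/
theorem expect_centredSum_mul_dotProduct_ge (hJ : J ∈ symZeroDiag n) {δ : ℝ}
    (hrow : ∀ i, ∑ j, |J i j| ≤ 1 - δ) (a : EuclideanSpace ℝ (Fin n)) :
    δ * ‖a‖ ^ 2 ≤ expect J (fun x => centredSum J a x * (a.ofLp ⬝ᵥ x.toVec)) := by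
  rw [expect_centredSum_mul hJ, EuclideanSpace.norm_sq_eq, Finset.mul_sum]
  refine Finset.sum_le_sum fun i _ => ?_
  have h1 : expect J (fun x => rate J i x * (x.toVec i *
      (a.ofLp ⬝ᵥ x.toVec - a.ofLp ⬝ᵥ (flip i x).toVec))) =
      a i * expect J (fun x => 2 * rate J i x) := by
    rw [← expect_const_mul]
    congr 1
    ext x
    rw [toVec_flip, dotProduct_sub, dotProduct_single]
    linear_combination (2 * rate J i x * a i) * toVec_sq x i
  have h2 : δ ≤ expect J (fun x => 2 * rate J i x) := by
    rw [← expect_const (J := J) δ]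
    refine expect_mono fun x => ?_
    have h3 : x.toVec i * Real.tanh (field J i x) ≤ 1 - δ := by
      refine (le_abs_self _).trans ?_
      rw [abs_mul, abs_toVec, one_mul]
      exact ((abs_tanh_le_abs _).trans (abs_field_le i x)).trans (hrow i)
    rw [rate]
    linarith
  rw [h1, Real.norm_eq_abs, sq_abs]
  nlinarith [mul_le_mul_of_nonneg_left h2 (sq_nonneg (a i))]

theorem oscBound_centredSum (hJ : J ∈ symZeroDiag n) (a : EuclideanSpace ℝ (Fin n)) :
    OscBound (centredSum J a) ((2 : ℝ) • ((WithLp.toLp 2 fun i => |a i|) +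
      absMulVec J (WithLp.toLp 2 fun i => |a i|))) := by
  intro x i
  have h1 (j : Fin n) : |a j * (x.toVec j - (flip i x).toVec j)| ≤
      if j = i then 2 * |a i| else 0 := by
    by_cases hji : j = i
    · subst hji
      rw [if_pos rfl, toVec_flip_self, sub_neg_eq_add, ← two_mul, abs_mul, abs_mul, abs_toVec,
        abs_two]
      linarith
    · simp [hji, toVec_flip_of_ne hji]
  have h2 (j : Fin n) : |a j * (Real.tanh (field J j x) - Real.tanh (field J j (flip i x)))| ≤
      2 * (|J i j| * |a j|) := by
    have h3 := abs_tanh_sub_tanh_le (field J j x) (field J j (flip i x))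
    rw [field_flip (J := J) j i x, sub_sub_cancel, abs_mul, abs_mul, abs_toVec, abs_two,
      hJ.1.apply, mul_one] at h3
    rw [abs_mul, field_flip, hJ.1.apply]
    nlinarith [mul_le_mul_of_nonneg_left h3 (abs_nonneg (a j))]
  have h4 : centredSum J a x - centredSum J a (flip i x) =
      ∑ j, (a j * (x.toVec j - (flip i x).toVec j) -
        a j * (Real.tanh (field J j x) - Real.tanh (field J j (flip i x)))) := by
    rw [centredSum, centredSum, ← Finset.sum_sub_distrib]
    exact Finset.sum_congr rfl fun j _ => by ring
  rw [h4]
  calc _ ≤ ∑ j, ((if j = i then 2 * |a i| else 0) + 2 * (|J i j| * |a j|)) :=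
        (Finset.abs_sum_le_sum_abs _ _).trans (Finset.sum_le_sum fun j _ =>
          (abs_sub _ _).trans (add_le_add (h1 j) (h2 j)))
    _ = _ := by
        simp only [Finset.sum_add_distrib, Finset.sum_ite_eq', Finset.mem_univ, if_true,
          PiLp.smul_apply, PiLp.add_apply, smul_eq_mul, absMulVec, mul_add, ← Finset.mul_sum]

theorem expect_dotProduct_sq_ge (hJ : J ∈ symZeroDiag n) {δ : ℝ} (hδ : 0 < δ) (hδ1 : δ ≤ 1)
    (hrow : ∀ i, ∑ j, |J i j| ≤ 1 - δ) (hc : ContractsBy J δ) (a : EuclideanSpace ℝ (Fin n)) :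
    δ ^ 3 / 8 * ‖a‖ ^ 2 ≤ expect J (fun x => (a.ofLp ⬝ᵥ x.toVec) ^ 2) := by
  set D : EuclideanSpace ℝ (Fin n) := (2 : ℝ) • ((WithLp.toLp 2 fun i => |a i|) +
    absMulVec J (WithLp.toLp 2 fun i => |a i|)) with hD
  have h1 : ‖D‖ ≤ 4 * ‖a‖ := by
    have h2 := hc (WithLp.toLp 2 fun i => |a i|)
    have h3 := norm_add_le (WithLp.toLp 2 fun i => |a i|)
      (absMulVec J (WithLp.toLp 2 fun i => |a i|))
    rw [norm_toLp_abs] at h2 h3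
    rw [hD, norm_smul, Real.norm_ofNat]
    nlinarith [norm_nonneg a]
  have h4 : expect J (fun x => centredSum J a x ^ 2) ≤ 8 * ‖a‖ ^ 2 / δ := by
    refine (expect_sq_le_of_oscBound hJ hδ hδ1 hc (oscBound_centredSum hJ a)
      (expect_centredSum hJ a)).trans ?_
    calc _ ≤ (4 * ‖a‖) ^ 2 / (2 * δ) := by gcongr
      _ = _ := by
        field_simp
        ring
  have h5 := expect_centredSum_mul_dotProduct_ge hJ hrow a
  have h6 := expect_mul_sq_le (J := J) (centredSum J a) fun x => a.ofLp ⬝ᵥ x.toVec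
  have h7 : 0 ≤ expect J (fun x => (a.ofLp ⬝ᵥ x.toVec) ^ 2) := by
    rw [← expect_const (J := J) 0]
    exact expect_mono fun x => sq_nonneg _
  -- The last step cancels the variance bound `8 ‖a‖² / δ`, so `a = 0` is treated apart.
  rcases (norm_nonneg a).eq_or_lt with h0 | h0
  · simpa [← h0] using h7
  have h8 : (δ * ‖a‖ ^ 2) ^ 2 ≤
      8 * ‖a‖ ^ 2 / δ * expect J (fun x => (a.ofLp ⬝ᵥ x.toVec) ^ 2) := by
    refine (pow_le_pow_left₀ (by positivity) h5 2).trans (h6.trans ?_)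
    exact mul_le_mul_of_nonneg_right h4 h7
  have h9 : 0 < 8 * ‖a‖ ^ 2 / δ := by positivity
  refine le_of_mul_le_mul_left (le_trans (le_of_eq ?_) h8) h9
  field_simp

/-! ### Frobenius norms and the regularity theorem -/

/-- The `i`-th row of a matrix as a Euclidean vector. -/
def rowVec (A : Matrix (Fin n) (Fin n) ℝ) (i : Fin n) : EuclideanSpace ℝ (Fin n) :=
  WithLp.toLp 2 (A i)

theorem expect_sqNormMulVec (A : Matrix (Fin n) (Fin n) ℝ) :
    expect J (sqNormMulVec A) = ∑ i, expect J (fun x => ((rowVec A i).ofLp ⬝ᵥ x.toVec) ^ 2) := by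
  rw [← expect_sum]
  congr 1
  ext x
  simp only [sqNormMulVec, EuclideanSpace.norm_sq_eq, Real.norm_eq_abs, sq_abs]
  rfl

/-- Schur's test: weighted Cauchy–Schwarz in each row, then symmetry turns row sums into column
sums. -/
theorem contractsBy_of_row_sum_le (hJ : J ∈ symZeroDiag n) {η : ℝ} (hη1 : η ≤ 1)
    (hrow : ∀ i, ∑ j, |J i j| ≤ 1 - η) : ContractsBy J η := by
  intro v
  refine le_of_sq_le_sq ?_ (mul_nonneg (by linarith) (norm_nonneg _))
  rw [mul_pow, EuclideanSpace.norm_sq_eq, EuclideanSpace.norm_sq_eq]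
  simp only [Real.norm_eq_abs, sq_abs, absMulVec]
  have h1 (i : Fin n) : (∑ j, |J i j| * v j) ^ 2 ≤ (1 - η) * ∑ j, |J i j| * v j ^ 2 := by
    refine (Finset.sum_sq_le_sum_mul_sum_of_sq_le_mul _ (f := fun j => |J i j|)
      (g := fun j => |J i j| * v j ^ 2) (fun j _ => abs_nonneg _)
      (fun j _ => by positivity) fun j _ => le_of_eq (by ring)).trans ?_
    exact mul_le_mul_of_nonneg_right (hrow i) (Finset.sum_nonneg fun j _ => by positivity)
  calc _ ≤ ∑ i, (1 - η) * ∑ j, |J i j| * v j ^ 2 := Finset.sum_le_sum fun i _ => h1 i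
    _ = (1 - η) * ∑ j, (∑ i, |J j i|) * v j ^ 2 := by
        rw [← Finset.mul_sum, Finset.sum_comm]
        simp only [Finset.sum_mul, hJ.1.apply]
    _ ≤ (1 - η) * ∑ j, (1 - η) * v j ^ 2 := by
        refine mul_le_mul_of_nonneg_left (Finset.sum_le_sum fun j _ => ?_) (by linarith)
        exact mul_le_mul_of_nonneg_right (hrow j) (sq_nonneg _)
    _ = _ := by
        rw [← Finset.mul_sum]
        ring

theorem norm_absMulVec_le (A : Matrix (Fin n) (Fin n) ℝ) (v : EuclideanSpace ℝ (Fin n)) :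
    ‖absMulVec A v‖ ^ 2 ≤ (∑ i, ‖rowVec A i‖ ^ 2) * ‖v‖ ^ 2 := by
  simp only [EuclideanSpace.norm_sq_eq, Real.norm_eq_abs, sq_abs, Finset.sum_mul, absMulVec,
    rowVec]
  refine Finset.sum_le_sum fun i _ => (Finset.sum_mul_sq_le_sq_mul_sq _ _ _).trans (le_of_eq ?_)
  simp only [sq_abs, ← Finset.sum_mul]

theorem contractsBy_of_frobenius_le {Jstar : Matrix (Fin n) (Fin n) ℝ} {η ζ : ℝ} (hζ : 0 ≤ ζ)
    (hc : ContractsBy Jstar η) (h : ∑ i, ‖rowVec (J - Jstar) i‖ ^ 2 ≤ ζ ^ 2) :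
    ContractsBy J (η - ζ) := by
  intro v
  -- Entrywise `|J| ≤ |Jstar| + |J - Jstar|` can only be applied to a nonnegative vector.
  set w : EuclideanSpace ℝ (Fin n) := WithLp.toLp 2 fun i => |v i| with hw
  have h1 : ‖absMulVec J v‖ ≤ ‖absMulVec Jstar w + absMulVec (J - Jstar) w‖ := by
    refine le_of_sq_le_sq ?_ (norm_nonneg _)
    rw [EuclideanSpace.norm_sq_eq, EuclideanSpace.norm_sq_eq]
    refine Finset.sum_le_sum fun i _ => pow_le_pow_left₀ (norm_nonneg _) ?_ 2
    rw [Real.norm_eq_abs, Real.norm_eq_abs]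
    refine le_trans ?_ (le_abs_self _)
    simp only [absMulVec, PiLp.add_apply, ← Finset.sum_add_distrib, hw]
    refine (Finset.abs_sum_le_sum_abs _ _).trans (Finset.sum_le_sum fun j _ => ?_)
    rw [abs_mul, abs_abs, ← add_mul]
    refine mul_le_mul_of_nonneg_right ?_ (abs_nonneg _)
    have := abs_add_le (Jstar i j) ((J - Jstar) i j)
    rwa [Matrix.sub_apply, add_sub_cancel] at this
  have h2 : ‖absMulVec (J - Jstar) w‖ ≤ ζ * ‖w‖ := by
    refine le_of_sq_le_sq ?_ (by positivity)
    rw [mul_pow]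
    exact (norm_absMulVec_le _ _).trans (mul_le_mul_of_nonneg_right h (sq_nonneg _))
  have h3 := hc w
  rw [norm_toLp_abs] at h2 h3
  linarith [norm_add_le (absMulVec Jstar w) (absMulVec (J - Jstar) w)]

theorem row_sum_le_infNorm (A : Matrix (Fin n) (Fin n) ℝ) (i : Fin n) :
    ∑ j, |A i j| ≤ infNorm A :=
  le_ciSup (f := fun i => ∑ j, |A i j|) (Set.finite_range _).bddAbove i

theorem infNorm_nonneg (A : Matrix (Fin n) (Fin n) ℝ) : 0 ≤ infNorm A :=
  Real.iSup_nonneg fun _ => Finset.sum_nonneg fun _ _ => abs_nonneg _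

theorem isRegular_of_infNorm_lt {Jstar : Matrix (Fin n) (Fin n) ℝ} {δ : ℝ} (hδ : 0 < δ)
    (hJs : Jstar ∈ symZeroDiag n) (h : infNorm Jstar < 1 - δ) :
    IsRegular Jstar (δ ^ 5 / 32) (32 / δ ^ 4) := by
  intro J hJ hE
  have hδ1 : δ ≤ 1 := by linarith [infNorm_nonneg Jstar]
  have hrow (i : Fin n) : ∑ j, |Jstar i j| ≤ 1 - δ := (row_sum_le_infNorm Jstar i).trans h.le
  have hcs := contractsBy_of_row_sum_le hJs hδ1 hrow
  set F := ∑ i, ‖rowVec (J - Jstar) i‖ ^ 2 with hF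
  have hlow : δ ^ 3 / 8 * F ≤ expect Jstar (sqNormMulVec (J - Jstar)) := by
    rw [expect_sqNormMulVec, hF, Finset.mul_sum]
    exact Finset.sum_le_sum fun i _ => expect_dotProduct_sq_ge hJs hδ hδ1 hrow hcs _
  -- The threshold is chosen so that `δ ^ 5 / 32 = δ ^ 3 / 8 * (δ / 2) ^ 2`: passing to `J` then
  -- costs half of the contraction margin `δ`.
  have hFle : F ≤ (δ / 2) ^ 2 := by
    refine le_of_mul_le_mul_left ((hlow.trans hE).trans (le_of_eq ?_))
      (by positivity : 0 < δ ^ 3 / 8)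
    ring
  have hc : ContractsBy J (δ / 2) := by
    have := contractsBy_of_frobenius_le (by positivity) hcs hFle
    rwa [sub_half] at this
  have hup : expect J (sqNormMulVec (J - Jstar)) ≤ 2 / (δ / 2) * F := by
    rw [expect_sqNormMulVec, hF, Finset.mul_sum]
    exact Finset.sum_le_sum fun i _ =>
      expect_dotProduct_sq_le hJ (by positivity) (by linarith) hc _
  calc _ ≤ 2 / (δ / 2) * F := hup
    _ = 32 / δ ^ 4 * (δ ^ 3 / 8 * F) := by
        field_simp
        ring
    _ ≤ _ := mul_le_mul_of_nonneg_left hlow (by positivity)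

end Ising

theorem mainTheorem10 (δ : ℝ) (hδ : 0 < δ) :
    ∃ ε₀ : ℝ, 0 < ε₀ ∧ ∃ C : ℝ, 0 < C ∧
      ∀ (n : ℕ) (Jstar : Matrix (Fin n) (Fin n) ℝ),
        Jstar ∈ Ising.symZeroDiag n → Ising.infNorm Jstar < 1 - δ →
          Ising.IsRegular Jstar (ε₀ ^ 2) C := by
  refine ⟨√(δ ^ 5 / 32), by positivity, 32 / δ ^ 4, by positivity, fun n Jstar hJ h => ?_⟩
  rw [Real.sq_sqrt (by positivity)]
  exact Ising.isRegular_of_infNorm_lt hδ hJ h
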